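/- Let $F$ be a non-archimedean local field with ring of integers $O$, normalized valuation $v$, uniformizer $\varpi$, residue field of cardinality $p$ and absolute value $|x|=p^{-v(x)}$, let $\psi$ be an unramified additive character of $F$ (trivial on $O$ but not on $\varpi^{-1}O$), and let $k\ge 1$. Let $\mu_1,\mu_2$ be quasi-characters of $F^\times$, both of level $k$ (trivial on $1+\varpi^{k}O$, but not on $1+\varpi^{k-1}O$ if $k\geq 2$, respectively not on $O^\times$ if $k=1$), and let $\alpha\in\mathbb{R}$ be a bound towards the Ramanujan conjecture for them, i.e. $p^{-\alpha}\le|\mu_i(\varpi)|\le p^{\alpha}$ for $i=1,2$ (for instance, any admissible $\alpha\leq 7/64$). Let $\varphi$ be a newform in the induced model of $\pi=\pi(\mu_1,\mu_2)$, that is, a function on $\mathrm{GL}_2(F)$ with $$\varphi\left(\begin{pmatrix}a&b\\0&d\end{pmatrix}g\right)=\mu_1(a)\mu_2(d)\left|\frac ad\right|^{1/2}\varphi(g)$$ which is right invariant under $K_1(\varpi^{2k})=\left\{\kappa\in \mathrm{GL}_2(O):\kappa\equiv\begin{pmatrix}*&*\\0&1\end{pmatrix}\bmod \varpi^{2k}\right\}$,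 and let $$W(g)=\int_{F}\varphi\left(\begin{pmatrix}0&1\\-1&0\end{pmatrix}\begin{pmatrix}1&m\\0&1\end{pmatrix}g\right)\psi(-m)\,dm$$ be its Whittaker function, where $dm$ is the Haar measure with $\mathrm{vol}(O)=1$, the integral is the limit for $N\to\infty$ of the integrals over $v(m)\ge -N$, and $\varphi$ is scaled so that $W(1)=1$. For $a\in F^\times$ put $$W^{(k)}(a)=W\left(\begin{pmatrix}a&0\\0&1\end{pmatrix}\begin{pmatrix}1&0\\\varpi^k&1\end{pmatrix}\right).$$ Then there is a constant $C>0$ depending only on $k$ and $p$ such that for all $a\in F^\times$ $$|W^{(k)}(a)|\le C\,p^{(\alpha-1/2)v(a)}\max(1,|v(a)|).$$ -/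

import Mathlib

open MeasureTheory Filter Topology

namespace GL2Whittaker

section

variable (F : Type*) [Field F] [ValuativeRel F] [TopologicalSpace F]
  [IsNonarchimedeanLocalField F]

/-- The cardinality of the residue field of a non-archimedean local field `F`. -/
noncomputable def resCard : ℕ := Nat.card (IsLocalRing.ResidueField (ValuativeRel.valuation F).integer)

variable {F}

/-- The normalized additive valuation `v : F → ℤ`, equal to `1` on uniformizers
(with the junk value `0` at `0`, which is never used below). -/
noncomputable def ord (x : F) : ℤ :=
  -WithZero.log (IsNonarchimedeanLocalField.valueGroupWithZeroIsoInt F (ValuativeRel.valuation F x))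

/-- The normalized absolute value `|x| = p ^ (-v x)` for `x ≠ 0`, `|0| = 0`,
where `p` is the cardinality of the residue field. -/
noncomputable def nabs (x : F) : ℝ := by
  classical
  exact if x = 0 then 0 else (resCard F : ℝ) ^ (-ord x)

variable (F)

/-- The fractional ideal `ϖ ^ n O` of all `x` with `|x| ≤ p ^ (-n)`. -/
def fracIdeal (n : ℤ) : Set F := {x | nabs x ≤ (resCard F : ℝ) ^ (-n)}

/-- The unit filtration: `O ^ *` for `j = 0`, and `1 + ϖ ^ j O` for `j ≥ 1`. -/
def unitGroup (j : ℕ) : Set Fˣ := {u | nabs (u : F) = 1 ∧ (u : F) - 1 ∈ fracIdeal F j}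

variable {F}

/-- A character `μ` of `F ^ *` is of level `k` if `k` is the least `j` such that `μ` is trivial on
the `j`-th unit group. Triviality on such an open subgroup includes the continuity of `μ`.
`μ` is ramified iff `k ≥ 1`. The character is not assumed to be unitary. -/
def HasLevel (μ : Fˣ →* ℂˣ) (k : ℕ) : Prop :=
  (∀ u ∈ unitGroup F k, μ u = 1) ∧ ∀ j < k, ∃ u ∈ unitGroup F j, μ u ≠ 1

/-- An additive character of `F` is unramified if `O` is the largest fractional ideal on which it is
trivial. (This includes its continuity.) -/
def IsUnramified (ψ : AddChar F Circle) : Prop :=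
  (∀ x ∈ fracIdeal F 0, ψ x = 1) ∧ ∃ x ∈ fracIdeal F (-1), ψ x ≠ 1

/-- The matrix with rows `(a, b)` and `(0, d)`. -/
noncomputable def upper (a : Fˣ) (b : F) (d : Fˣ) : GL (Fin 2) F :=
  Matrix.GeneralLinearGroup.mkOfDetNeZero !![(a : F), b; 0, (d : F)] (by simp)

/-- The matrix with rows `(1, 0)` and `(x, 1)`. -/
noncomputable def lower (x : F) : GL (Fin 2) F :=
  Matrix.GeneralLinearGroup.mkOfDetNeZero !![1, 0; x, 1] (by simp)

variable (F) in
/-- The matrix `ω` with rows `(0, 1)` and `(-1, 0)`. -/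
noncomputable def weyl : GL (Fin 2) F :=
  Matrix.GeneralLinearGroup.mkOfDetNeZero !![0, 1; -1, 0] (by simp)

variable (F) in
/-- `K_1(ϖ ^ c)`: the matrices in `GL_2(O)` whose lower row is congruent to `(0, 1)`
modulo `ϖ ^ c`. -/
def K1 (c : ℕ) : Set (GL (Fin 2) F) :=
  {g | (∀ i j, (g : Matrix (Fin 2) (Fin 2) F) i j ∈ fracIdeal F 0) ∧
    nabs (g : Matrix (Fin 2) (Fin 2) F).det = 1 ∧
    (g : Matrix (Fin 2) (Fin 2) F) 1 0 ∈ fracIdeal F c ∧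
    (g : Matrix (Fin 2) (Fin 2) F) 1 1 - 1 ∈ fracIdeal F c}

/-- `φ` lies in the (normalized) induced model of `π(μ₁, μ₂)` and is right invariant under
`K_1(ϖ ^ c)`. (Right invariance under this open subgroup includes the smoothness of `φ`.) -/
structure IsFixedVector (μ₁ μ₂ : Fˣ →* ℂˣ) (c : ℕ) (φ : GL (Fin 2) F → ℂ) : Prop where
  equivariant : ∀ (a : Fˣ) (b : F) (d : Fˣ) (g : GL (Fin 2) F),
    φ (upper a b d * g) =
      (μ₁ a : ℂ) * (μ₂ d : ℂ) * (Real.sqrt (nabs (a : F) / nabs (d : F)) : ℂ) * φ g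
  invariant : ∀ g : GL (Fin 2) F, ∀ κ ∈ K1 F c, φ (g * κ) = φ g

/-- `W` is the Whittaker function of `φ`:
`W(g) = ∫_F φ(ω n(m) g) ψ(-m) dm`, where `n(m)` has rows `(1, m)` and `(0, 1)`. As usual the
integral is the limit of the integrals over the compact balls `v(m) ≥ -N` for `N → ∞`. -/
def IsWhittakerTransform [MeasurableSpace F] (dm : Measure F) (ψ : AddChar F Circle)
    (φ W : GL (Fin 2) F → ℂ) : Prop :=
  ∀ g : GL (Fin 2) F, Tendsto
    (fun N : ℕ => ∫ m in fracIdeal F (-(N : ℤ)), φ (weyl F * upper 1 m 1 * g) * (ψ (-m) : ℂ) ∂dm)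
    atTop (𝓝 (W g))

/-- `W` is the normalized Whittaker newform of `π(μ₁, μ₂)`, where `μ₁` and `μ₂` have level `k`
(so that `π(μ₁, μ₂)` has level `2k`): it is the Whittaker function of a `K_1(ϖ ^ (2k))`-invariant
vector of the induced model, scaled so that `W(1) = 1`. -/
def IsWhittakerNewform [MeasurableSpace F] (dm : Measure F) (ψ : AddChar F Circle)
    (μ₁ μ₂ : Fˣ →* ℂˣ) (k : ℕ) (W : GL (Fin 2) F → ℂ) : Prop :=
  (∃ φ, IsFixedVector μ₁ μ₂ (2 * k) φ ∧ IsWhittakerTransform dm ψ φ W) ∧ W 1 = 1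

/-- `α` is a bound towards the Ramanujan conjecture for the character `μ`:
`p ^ (-α) ≤ |μ(ϖ)| ≤ p ^ α`. As characters are unitary on `O ^ *`, the choice of the uniformizer
`ϖ` does not matter. -/
def IsRamanujanBound (α : ℝ) (ϖ : Fˣ) (μ : Fˣ →* ℂˣ) : Prop :=
  (resCard F : ℝ) ^ (-α) ≤ ‖(μ ϖ : ℂ)‖ ∧ ‖(μ ϖ : ℂ)‖ ≤ (resCard F : ℝ) ^ α

/-- `W^{(i)}(a)`, the value of `W` at the product of the diagonal matrix `(a, 1)` and the lower
triangular unipotent matrix with entry `ϖ ^ i`. -/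
noncomputable def whittakerCoset (W : GL (Fin 2) F → ℂ) (ϖ : Fˣ) (i : ℕ) (a : Fˣ) : ℂ :=
  W (upper a 0 1 * lower ((ϖ : F) ^ i))

end

end GL2Whittaker

open GL2Whittaker

/-!
The Whittaker function at `diag(a, 1) * lower z` is the integral over `m` of
`φ(w n(m) diag(a, 1) lower z) ψ(-m)`. For `m ≠ 0` the Iwasawa decomposition
(`IsFixedVector.orbitValue_eq`) expresses this value of `φ` as an explicit product of values of `μ₁`,
`μ₂` and absolute values, times `φ(lower (z + a / m))`. So everything depends on the function
`x ↦ φ(lower x)`. Invariance under `K_1(ϖ ^ (2k))` and the exact levels of `μ₁` and `μ₂` force it to be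
supported on the shell `v x = k` (`IsFixedVector.ord_eq_of_apply_lower_ne_zero`), where its
absolute value is constant, since quasi-characters are unitary on `O ^ *`.

*Normalization.* For `a = 1`, `z = 0` only the shell `v m = -k` contributes, and `W(1)` is
`φ(lower (ϖ ^ k))` times an elementary factor and a Gauss sum of `μ₂`. Fourier inversion on `O` bounds
the Gauss sum from below (`norm_gaussSum_ge`), so `W(1) = 1` bounds `φ(lower (ϖ ^ k))` from above
(`norm_apply_lower_le_of_normalized`).

*The bound.* For `z = ϖ ^ k` the integral is split into the shells `v m = n`.
* For `n > v a - k` the integrand is zero, because `v (z + a / m) < k`.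
* For `n < -k` the substitution `m ↦ m + s` with `v s ≥ n + k` leaves all but the factor `ψ(-m)`
  unchanged, and `ψ` is not trivial on these `s`, so the shell contributes zero
  (`setIntegral_shell_eq_zero`).
* For `-k ≤ n ≤ v a - k` the trivial estimate gives a constant times
  `p ^ (-v a / 2) |μ₁(ϖ)| ^ (v a - n - k) |μ₂(ϖ)| ^ (n + k)`. Both exponents are nonnegative with sum
  `v a`, so this is at most a constant times `p ^ ((α - 1 / 2) v a)`, uniformly in `α`
  (`norm_setIntegral_shell_le`).

There are at most `v a + 1` shells of the last kind, and none if `v a < 0`.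
-/

namespace GL2Whittaker

variable {F : Type*} [Field F] [ValuativeRel F] [TopologicalSpace F]
  [IsNonarchimedeanLocalField F]

open IsNonarchimedeanLocalField ValuativeRel WithZero

/-! ### The valuation and the fractional ideals -/

variable (F) in
theorem one_lt_resCard : 1 < resCard F := Finite.one_lt_card

variable (F) in
theorem one_lt_resCard_real : (1 : ℝ) < resCard F := by exact_mod_cast one_lt_resCard F

variable (F) in
theorem resCard_pos : (0 : ℝ) < resCard F := by linarith [one_lt_resCard_real F]

theorem valueIso_ne_zero {x : F} (hx : x ≠ 0) :
    valueGroupWithZeroIsoInt F (valuation F x) ≠ 0 := by simpa using hx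

theorem ord_mul {x y : F} (hx : x ≠ 0) (hy : y ≠ 0) : ord (x * y) = ord x + ord y := by
  simp only [ord, map_mul]
  rw [log_mul (valueIso_ne_zero hx) (valueIso_ne_zero hy)]
  ring

@[simp] theorem ord_one : ord (1 : F) = 0 := by simp [ord]

@[simp] theorem ord_neg (x : F) : ord (-x) = ord x := by simp [ord, Valuation.map_neg]

@[simp] theorem ord_inv (x : F) : ord x⁻¹ = -ord x := by
  simp [ord]

theorem ord_pow {x : F} (hx : x ≠ 0) (n : ℕ) : ord (x ^ n) = n * ord x := by
  induction n with
  | zero => simp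
  | succ n ih => rw [pow_succ, ord_mul (pow_ne_zero _ hx) hx, ih]; push_cast; ring

theorem ord_zpow {x : F} (hx : x ≠ 0) (n : ℤ) : ord (x ^ n) = n * ord x := by
  cases n with
  | ofNat n => simpa using ord_pow hx n
  | negSucc n => rw [zpow_negSucc, ord_inv, ord_pow hx, Int.negSucc_eq]; push_cast; ring

theorem nabs_eq {x : F} (hx : x ≠ 0) : nabs x = (resCard F : ℝ) ^ (-ord x) := by
  simp [nabs, hx]

theorem mem_fracIdeal_iff {n : ℤ} {x : F} : x ∈ fracIdeal F n ↔ x = 0 ∨ n ≤ ord x := by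
  have hp := one_lt_resCard_real F
  by_cases hx : x = 0
  · subst hx
    simp only [fracIdeal, nabs, Set.mem_ofPred_eq, if_true, true_or, iff_true]
    positivity
  · simp only [fracIdeal, Set.mem_ofPred_eq, hx, false_or, nabs_eq hx]
    rw [zpow_le_zpow_iff_right₀ hp]
    omega

theorem mem_fracIdeal_iff_of_ne {n : ℤ} {x : F} (hx : x ≠ 0) :
    x ∈ fracIdeal F n ↔ n ≤ ord x := by simp [mem_fracIdeal_iff, hx]

theorem mem_fracIdeal_iff_valuation {n : ℤ} {x : F} :
    x ∈ fracIdeal F n ↔ valueGroupWithZeroIsoInt F (valuation F x) ≤ exp (-n) := by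
  by_cases hx : x = 0
  · simp [hx, mem_fracIdeal_iff]
  · rw [mem_fracIdeal_iff_of_ne hx, ← log_le_iff_le_exp (valueIso_ne_zero hx), ord]
    omega

@[simp] theorem zero_mem_fracIdeal (n : ℤ) : (0 : F) ∈ fracIdeal F n := by
  simp [mem_fracIdeal_iff]

theorem add_mem_fracIdeal {n : ℤ} {x y : F} (hx : x ∈ fracIdeal F n) (hy : y ∈ fracIdeal F n) :
    x + y ∈ fracIdeal F n := by
  rw [mem_fracIdeal_iff_valuation] at *
  have h := (valueGroupWithZeroIsoInt F).strictMono.monotone ((valuation F).map_add x y)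
  rw [(valueGroupWithZeroIsoInt F).strictMono.monotone.map_max] at h
  exact h.trans (max_le hx hy)

theorem neg_mem_fracIdeal {n : ℤ} {x : F} (hx : x ∈ fracIdeal F n) : -x ∈ fracIdeal F n := by
  rw [mem_fracIdeal_iff] at *
  simpa using hx

theorem sub_mem_fracIdeal {n : ℤ} {x y : F} (hx : x ∈ fracIdeal F n) (hy : y ∈ fracIdeal F n) :
    x - y ∈ fracIdeal F n := by
  rw [sub_eq_add_neg]
  exact add_mem_fracIdeal hx (neg_mem_fracIdeal hy)

theorem mul_mem_fracIdeal {m n : ℤ} {x y : F} (hx : x ∈ fracIdeal F m) (hy : y ∈ fracIdeal F n) :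
    x * y ∈ fracIdeal F (m + n) := by
  by_cases hx0 : x = 0
  · simp [hx0]
  by_cases hy0 : y = 0
  · simp [hy0]
  rw [mem_fracIdeal_iff_of_ne hx0] at hx
  rw [mem_fracIdeal_iff_of_ne hy0] at hy
  rw [mem_fracIdeal_iff_of_ne (mul_ne_zero hx0 hy0), ord_mul hx0 hy0]
  omega

theorem fracIdeal_anti {m n : ℤ} (h : m ≤ n) : fracIdeal F n ⊆ fracIdeal F m := by
  intro x hx
  rw [mem_fracIdeal_iff] at *
  exact hx.imp_right h.trans

theorem mem_fracIdeal_ord (x : F) : x ∈ fracIdeal F (ord x) := by simp [mem_fracIdeal_iff]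

/-- Adding an element of larger valuation changes neither the valuation nor being nonzero. -/
theorem ord_add_of_mem {x y : F} (hx : x ≠ 0) (hy : y ∈ fracIdeal F (ord x + 1)) :
    x + y ≠ 0 ∧ ord (x + y) = ord x := by
  have key : x + y ∉ fracIdeal F (ord x + 1) := by
    intro h
    have := sub_mem_fracIdeal h hy
    rw [add_sub_cancel_right, mem_fracIdeal_iff_of_ne hx] at this
    omega
  have h1 : x + y ≠ 0 := by
    rintro h
    simp [h] at key
  have h2 := add_mem_fracIdeal (mem_fracIdeal_ord x) (fracIdeal_anti (by omega) hy)
  rw [mem_fracIdeal_iff_of_ne h1] at h2 key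
  exact ⟨h1, by omega⟩

theorem mem_unitGroup_iff {j : ℕ} {u : Fˣ} :
    u ∈ unitGroup F j ↔ ord (u : F) = 0 ∧ (u : F) - 1 ∈ fracIdeal F j := by
  have hp := one_lt_resCard_real F
  rw [unitGroup, Set.mem_ofPred_eq, nabs_eq u.ne_zero, zpow_eq_one_iff_right₀ (by linarith) hp.ne']
  simp

theorem nabs_eq_one_iff {x : F} : nabs x = 1 ↔ x ≠ 0 ∧ ord x = 0 := by
  have hp := one_lt_resCard_real F
  by_cases hx : x = 0
  · simp [hx, nabs]
  · rw [nabs_eq hx, zpow_eq_one_iff_right₀ (by linarith) hp.ne']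
    simp [hx]

theorem isOpen_fracIdeal (n : ℤ) : IsOpen (fracIdeal F n) := by
  obtain ⟨y, hy⟩ := (valuation_surjective
    ((valueGroupWithZeroIsoInt F).symm (exp (-n))))
  have hy0 : y ≠ 0 := by
    rintro rfl
    rw [map_zero, eq_comm, map_eq_zero] at hy
    simp at hy
  have h : fracIdeal F n ∈ 𝓝 (0 : F) := by
    rw [(IsValuativeTopology.hasBasis_nhds_zero' F).mem_iff]
    refine ⟨valuation F y, by simpa using hy0, fun x hx => ?_⟩
    rw [mem_fracIdeal_iff_valuation]
    have := (valueGroupWithZeroIsoInt F).strictMono.monotone (le_of_lt hx)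
    rwa [hy, OrderMonoidIso.apply_symm_apply] at this
  rw [isOpen_iff_mem_nhds]
  intro x hx
  have h2 : (fun z => z - x) ⁻¹' (fracIdeal F n) ∈ 𝓝 x :=
    (continuous_id.sub continuous_const).continuousAt.preimage_mem_nhds (by simpa using h)
  filter_upwards [h2] with z hz
  simpa using add_mem_fracIdeal hz hx

theorem isCompact_fracIdeal (n : ℤ) : IsCompact (fracIdeal F n) := by
  convert isCompact_closedBall F ((valueGroupWithZeroIsoInt F).symm (exp (-n))) using 1
  ext x
  rw [mem_fracIdeal_iff_valuation, Set.mem_ofPred_eq,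
    ← map_le_map_iff (valueGroupWithZeroIsoInt F) (b := OrderMonoidIso.symm _ _),
    OrderMonoidIso.apply_symm_apply]

/-- A function on `F` that is invariant under translation by some fractional ideal is
continuous. -/
theorem continuous_of_translation_invariant {E : Type*} [TopologicalSpace E] {f : F → E} (n : ℤ)
    (h : ∀ x, ∀ s ∈ fracIdeal F n, f (x + s) = f x) : Continuous f := by
  apply IsLocallyConstant.continuous
  rw [IsLocallyConstant.iff_eventually_eq]
  intro x
  have h2 : (fun z => z - x) ⁻¹' (fracIdeal F n) ∈ 𝓝 x :=
    (continuous_id.sub continuous_const).continuousAt.preimage_mem_nhds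
      (by simpa using (isOpen_fracIdeal n).mem_nhds (zero_mem_fracIdeal n))
  filter_upwards [h2] with z hz
  simpa using h x _ hz

/-! ### Topology and Haar measure -/

variable (F) in
theorem hasBasis_nhds_zero_fracIdeal :
    (𝓝 (0 : F)).HasBasis (fun _ : ℕ => True) (fun n => fracIdeal F n) := by
  refine (IsValuativeTopology.hasBasis_nhds_zero' F).to_hasBasis (fun γ hγ => ?_) (fun n _ => ?_)
  · have hγ' : valueGroupWithZeroIsoInt F γ ≠ 0 := by simpa using hγ
    refine ⟨(1 - log (valueGroupWithZeroIsoInt F γ)).toNat, trivial, fun x hx => ?_⟩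
    rw [mem_fracIdeal_iff_valuation] at hx
    rw [Set.mem_ofPred_eq, ← (valueGroupWithZeroIsoInt F).strictMono.lt_iff_lt]
    refine hx.trans_lt ?_
    rw [← lt_log_iff_exp_lt hγ']
    omega
  · exact (IsValuativeTopology.hasBasis_nhds_zero' F).mem_iff.mp
      ((isOpen_fracIdeal n).mem_nhds (zero_mem_fracIdeal n))

instance : SigmaCompactSpace F where
  isSigmaCompact_univ := by
    refine ⟨fun n => fracIdeal F (-(n : ℤ)), fun n => isCompact_fracIdeal _, ?_⟩
    refine Set.eq_univ_of_forall fun x => Set.mem_iUnion.mpr ⟨(-ord x).toNat, ?_⟩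
    exact fracIdeal_anti (by omega) (mem_fracIdeal_ord x)

/-- A local field is `σ`-compact and metrizable, hence second countable. This makes its Haar
measures unique up to scaling as measures, without any regularity assumption. -/
instance : SecondCountableTopology F := by
  let := IsTopologicalAddGroup.rightUniformSpace F
  have := isUniformAddGroup_of_addCommGroup (G := F)
  have : (𝓝 (0 : F)).IsCountablyGenerated := (hasBasis_nhds_zero_fracIdeal F).isCountablyGenerated
  have := IsUniformAddGroup.uniformity_countably_generated (α := F)
  let := UniformSpace.pseudoMetricSpace F
  exact EMetric.secondCountable_of_sigmaCompact F

theorem mul_mem_fracIdeal_add_ord_iff {c x : F} (hc : c ≠ 0) (n : ℤ) :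
    c * x ∈ fracIdeal F (n + ord c) ↔ x ∈ fracIdeal F n := by
  by_cases hx : x = 0
  · simp [hx]
  · rw [mem_fracIdeal_iff_of_ne hx, mem_fracIdeal_iff_of_ne (mul_ne_zero hc hx), ord_mul hc hx]
    omega

section Measure

variable [MeasurableSpace F] [BorelSpace F]

theorem measurableSet_fracIdeal (n : ℤ) : MeasurableSet (fracIdeal F n) :=
  (isOpen_fracIdeal n).measurableSet

variable (dm : Measure F) [dm.IsAddHaarMeasure]

omit [BorelSpace F] in
theorem measure_fracIdeal_lt_top (n : ℤ) : dm (fracIdeal F n) < ⊤ :=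
  (isCompact_fracIdeal n).measure_lt_top

/-- Multiplication by a nonzero element scales Haar measure by a constant. -/
theorem exists_map_mul_eq_smul (c : Fˣ) :
    ∃ s : NNReal, dm.map (fun x => (c : F) * x) = s • dm := by
  have h : (dm.map (fun x => (c : F) * x)).IsAddHaarMeasure :=
    ContinuousAddEquiv.isAddHaarMeasure_map dm
      { (Homeomorph.mulLeft₀ (c : F) c.ne_zero) with
        map_add' := fun x y => mul_add (c : F) x y }
  exact ⟨_, Measure.isAddLeftInvariant_eq_smul _ dm⟩

omit [dm.IsAddHaarMeasure] in
theorem map_mul_apply_fracIdeal (c : Fˣ) (n : ℤ) :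
    dm.map (fun x => (c : F) * x) (fracIdeal F n) = dm (fracIdeal F (n - ord (c : F))) := by
  rw [Measure.map_apply (by fun_prop) (measurableSet_fracIdeal n)]
  congr 1
  ext x
  rw [Set.mem_preimage, ← mul_mem_fracIdeal_add_ord_iff (n := n - ord (c : F)) c.ne_zero,
    sub_add_cancel]

variable {dm}

/-- Multiplication by a unit of `O` preserves Haar measure. -/
theorem measurePreserving_unit_mul {u : Fˣ} (hu : ord (u : F) = 0) :
    MeasurePreserving (fun x => (u : F) * x) dm dm := by
  refine ⟨by fun_prop, ?_⟩
  obtain ⟨s, hs⟩ := exists_map_mul_eq_smul dm u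
  have h := map_mul_apply_fracIdeal dm u 0
  rw [hs, hu, sub_zero, Measure.smul_apply, ENNReal.smul_def, smul_eq_mul] at h
  have h0 : dm (fracIdeal F 0) ≠ 0 :=
    ((isOpen_fracIdeal 0).measure_pos dm ⟨0, zero_mem_fracIdeal 0⟩).ne'
  have h1 := (measure_fracIdeal_lt_top dm 0).ne
  rw [ENNReal.mul_eq_right h0 h1] at h
  rw [hs, show s = 1 by exact_mod_cast h, one_smul]

/-- The ring of integers is the disjoint union of `p` translates of its maximal ideal. -/
theorem resCard_mul_measure_fracIdeal_one :
    (resCard F : ENNReal) * dm (fracIdeal F 1) = dm (fracIdeal F 0) := by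
  let O := (valuation F).integer
  have hO : (O : Set F) = fracIdeal F 0 := by
    ext x
    rw [mem_fracIdeal_iff_valuation, neg_zero, exp_zero, SetLike.mem_coe,
      Valuation.mem_integer_iff, ← map_one (valueGroupWithZeroIsoInt F),
      (valueGroupWithZeroIsoInt F).strictMono.le_iff_le]
  have hOm : MeasurableSet (O : Set F) := hO ▸ measurableSet_fracIdeal 0
  let H : AddSubgroup O := (IsLocalRing.maximalIdeal O).toAddSubgroup
  have hH : Subtype.val '' (H : Set O) = fracIdeal F 1 := by
    have hmem : ∀ x : O, x ∈ H ↔ (x : F) ∈ fracIdeal F 1 := by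
      intro x
      have h1 : x ∈ H ↔ valuation F (x : F) < 1 :=
        (IsLocalRing.mem_maximalIdeal x).trans
          Valuation.Integer.not_isUnit_iff_valuation_lt_one
      rw [h1, ← (valueGroupWithZeroIsoInt F).strictMono.lt_iff_lt, map_one]
      by_cases hx : (x : F) = 0
      · simp [hx]
      · rw [mem_fracIdeal_iff_of_ne hx, ← exp_zero, ← log_lt_iff_lt_exp (valueIso_ne_zero hx), ord]
        omega
    ext x
    constructor
    · rintro ⟨y, hy, rfl⟩
      exact (hmem y).1 hy
    · intro hx
      have : x ∈ (O : Set F) := hO ▸ fracIdeal_anti (by omega) hx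
      exact ⟨⟨x, this⟩, (hmem _).2 hx, rfl⟩
  have hind : H.index = resCard F := rfl
  have : H.FiniteIndex := ⟨by rw [hind]; exact (one_lt_resCard F).ne_bot⟩
  let μ : Measure O := dm.comap Subtype.val
  have hμ : ∀ s : Set O, MeasurableSet s → μ s = dm (Subtype.val '' s) := fun s hs =>
    Measure.comap_apply _ Subtype.val_injective
      (fun t ht => (MeasurableEmbedding.subtype_coe hOm).measurableSet_image.2 ht) _ hs
  have hinv : μ.IsAddLeftInvariant := by
    refine ⟨fun x => ?_⟩
    ext s hs
    rw [Measure.map_apply (measurable_const_add x) hs, hμ _ (measurable_const_add x hs), hμ _ hs,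
      ← measure_preimage_add dm (x : F) (Subtype.val '' s)]
    congr 1
    ext y
    constructor
    · rintro ⟨z, hz, rfl⟩
      exact ⟨x + z, hz, rfl⟩
    · rintro ⟨z, hz, h⟩
      have hy : y = ((z - x : O) : F) := by simp [h]
      exact ⟨z - x, by simpa using hz, hy.symm⟩
  have hHm : MeasurableSet (H : Set O) := by
    refine (MeasurableEmbedding.subtype_coe hOm).measurableSet_image.1 ?_
    change MeasurableSet (Subtype.val '' (H : Set O))
    exact hH ▸ measurableSet_fracIdeal 1
  have := H.index_mul_measure hHm μ
  rwa [hind, hμ _ hHm, hμ _ MeasurableSet.univ, hH, Set.image_univ, Subtype.range_coe, hO] at this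

theorem measureReal_fracIdeal {ϖ : Fˣ} (hϖ : ord (ϖ : F) = 1) (h1 : dm (fracIdeal F 0) = 1)
    (n : ℤ) : dm.real (fracIdeal F n) = (resCard F : ℝ) ^ (-n) := by
  have hp := resCard_pos F
  obtain ⟨s, hs⟩ := exists_map_mul_eq_smul dm ϖ
  have hstep : ∀ m : ℤ, (s : ℝ) * dm.real (fracIdeal F m) = dm.real (fracIdeal F (m - 1)) := by
    intro m
    have h := map_mul_apply_fracIdeal dm ϖ m
    rw [hs, hϖ, Measure.smul_apply, ENNReal.smul_def, smul_eq_mul] at h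
    rw [Measure.real, Measure.real, ← h, ENNReal.toReal_mul, ENNReal.coe_toReal]
  have h0 : dm.real (fracIdeal F 0) = 1 := by rw [Measure.real, h1, ENNReal.toReal_one]
  have hp1 : (resCard F : ℝ) * dm.real (fracIdeal F 1) = 1 := by
    rw [← h0, Measure.real, Measure.real, ← resCard_mul_measure_fracIdeal_one, ENNReal.toReal_mul,
      ENNReal.toReal_natCast]
  have hsp : (s : ℝ) = resCard F := by
    have h := hstep 1
    rw [sub_self, h0, ← hp1] at h
    exact mul_right_cancel₀ (right_ne_zero_of_mul (hp1.trans_ne one_ne_zero)) h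
  rw [hsp] at hstep
  induction n with
  | zero => simpa using h0
  | succ n ih =>
    have h := hstep (n + 1)
    rw [add_sub_cancel_right, ih] at h
    rw [neg_add, zpow_add₀ hp.ne', ← h]
    field_simp
  | pred n ih =>
    rw [← hstep, ih, ← zpow_one_add₀ hp.ne']
    congr 1
    ring

end Measure

/-! ### Quasi-characters on shells -/

open Classical in
/-- The restriction of a quasi-character `μ` to the shell `{m | v m = n}`, extended by zero to a
function on `F`. -/
noncomputable def shellChar (μ : Fˣ →* ℂˣ) (n : ℤ) (m : F) : ℂ :=
  if h : m ≠ 0 ∧ ord m = n then (μ (Units.mk0 m h.1) : ℂ) else 0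

theorem shellChar_of_ord (μ : Fˣ →* ℂˣ) {n : ℤ} {m : Fˣ} (h : ord (m : F) = n) :
    shellChar μ n m = μ m := by
  rw [shellChar, dif_pos ⟨m.ne_zero, h⟩, Units.mk0_val]

theorem shellChar_of_not (μ : Fˣ →* ℂˣ) {n : ℤ} {m : F} (h : ¬(m ≠ 0 ∧ ord m = n)) :
    shellChar μ n m = 0 := dif_neg h

theorem shellChar_unit_mul (μ : Fˣ →* ℂˣ) (n : ℤ) {u : Fˣ} (hu : ord (u : F) = 0) (m : F) :
    shellChar μ n (u * m) = μ u * shellChar μ n m := by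
  by_cases hm : m = 0
  · simp [hm, shellChar]
  lift m to Fˣ using IsUnit.mk0 m hm
  have h1 : ord (((u * m : Fˣ)) : F) = ord (m : F) := by
    rw [Units.val_mul, ord_mul u.ne_zero m.ne_zero, hu, zero_add]
  by_cases h : ord (m : F) = n
  · rw [← Units.val_mul, shellChar_of_ord μ (h1.trans h), shellChar_of_ord μ h]
    simp
  · rw [← Units.val_mul, shellChar_of_not μ (by rw [h1]; tauto), shellChar_of_not μ (by tauto),
      mul_zero]

/-- If `s` is small compared with `m`, then `(m + s) / m` lies in the `k`-th unit group. -/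
theorem exists_unitGroup_mul_eq_add {k : ℕ} (hk : 1 ≤ k) (m : Fˣ) {s : F}
    (hs : s ∈ fracIdeal F (ord (m : F) + k)) :
    ∃ u ∈ unitGroup F k, (m : F) + s = (m * u : Fˣ) := by
  obtain ⟨h0, h1⟩ := ord_add_of_mem m.ne_zero (fracIdeal_anti (by omega) hs)
  refine ⟨m⁻¹ * Units.mk0 _ h0, mem_unitGroup_iff.2 ⟨?_, ?_⟩, by simp⟩
  · rw [Units.val_mul, ord_mul (Units.ne_zero _) (Units.ne_zero _), Units.val_inv_eq_inv_val,
      ord_inv, Units.val_mk0, h1, neg_add_cancel]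
  · have h2 : ((m⁻¹ * Units.mk0 _ h0 : Fˣ) : F) - 1 = (m : F)⁻¹ * s := by
      rw [Units.val_mul, Units.val_inv_eq_inv_val, Units.val_mk0, mul_add,
        inv_mul_cancel₀ m.ne_zero, add_sub_cancel_left]
    rw [h2]
    have h3 := mul_mem_fracIdeal (mem_fracIdeal_ord (m : F)⁻¹) hs
    rwa [ord_inv, neg_add_cancel_left] at h3

theorem shellChar_add {μ : Fˣ →* ℂˣ} {k : ℕ} (hk : 1 ≤ k) (hμ : ∀ u ∈ unitGroup F k, μ u = 1)
    {n : ℤ} (m : F) {s : F} (hs : s ∈ fracIdeal F (n + k)) :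
    shellChar μ n (m + s) = shellChar μ n m := by
  have key : ∀ (m s : F), s ∈ fracIdeal F (n + k) → (m ≠ 0 ∧ ord m = n) →
      shellChar μ n (m + s) = shellChar μ n m := by
    rintro m s hs ⟨hm, hmn⟩
    lift m to Fˣ using IsUnit.mk0 m hm
    obtain ⟨u, hu, h⟩ := exists_unitGroup_mul_eq_add hk m (hmn.symm ▸ hs)
    rw [h, mul_comm, Units.val_mul, shellChar_unit_mul μ n (mem_unitGroup_iff.1 hu).1, hμ u hu]
    simp
  by_cases h : m ≠ 0 ∧ ord m = n
  · exact key m s hs h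
  by_cases h' : m + s ≠ 0 ∧ ord (m + s) = n
  · simpa using (key _ _ (neg_mem_fracIdeal hs) h').symm
  · rw [shellChar_of_not μ h, shellChar_of_not μ h']

theorem continuous_shellChar {μ : Fˣ →* ℂˣ} {k : ℕ} (hk : 1 ≤ k)
    (hμ : ∀ u ∈ unitGroup F k, μ u = 1) (n : ℤ) : Continuous (shellChar μ n) :=
  continuous_of_translation_invariant (n + k) fun m _ hs => shellChar_add hk hμ m hs

/-- A quasi-character is unitary on `O ^ *`, because it is bounded on this compact group. -/
theorem norm_apply_unit {μ : Fˣ →* ℂˣ} {k : ℕ} (hk : 1 ≤ k) (hμ : ∀ u ∈ unitGroup F k, μ u = 1)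
    {u : Fˣ} (hu : ord (u : F) = 0) : ‖(μ u : ℂ)‖ = 1 := by
  obtain ⟨M, hM⟩ := (isCompact_fracIdeal (F := F) 0).exists_bound_of_continuousOn
    (continuous_shellChar hk hμ 0).continuousOn
  have key : ∀ w : Fˣ, ord (w : F) = 0 → ‖(μ w : ℂ)‖ ≤ 1 := by
    intro w hw
    by_contra! h
    obtain ⟨n, hn⟩ := pow_unbounded_of_one_lt M h
    have hwn : ord ((w ^ n : Fˣ) : F) = 0 := by
      rw [Units.val_pow_eq_pow_val, ord_pow w.ne_zero, hw, mul_zero]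
    have h2 := hM ((w ^ n : Fˣ) : F) ((mem_fracIdeal_iff_of_ne (Units.ne_zero _)).2 hwn.ge)
    rw [shellChar_of_ord μ hwn, map_pow, Units.val_pow_eq_pow_val, norm_pow] at h2
    exact absurd h2 hn.not_ge
  refine le_antisymm (key u hu) ?_
  have h := key u⁻¹ (by simp [hu])
  rw [map_inv, Units.val_inv_eq_inv_val, norm_inv] at h
  exact (inv_le_one₀ (norm_pos_iff.2 (Units.ne_zero _))).1 h

theorem norm_apply_eq_zpow {μ : Fˣ →* ℂˣ} {k : ℕ} (hk : 1 ≤ k)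
    (hμ : ∀ u ∈ unitGroup F k, μ u = 1) {ϖ : Fˣ} (hϖ : ord (ϖ : F) = 1) (x : Fˣ) :
    ‖(μ x : ℂ)‖ = ‖(μ ϖ : ℂ)‖ ^ ord (x : F) := by
  have h : ord ((x * (ϖ ^ ord (x : F))⁻¹ : Fˣ) : F) = 0 := by
    rw [Units.val_mul, ord_mul x.ne_zero (Units.ne_zero _), Units.val_inv_eq_inv_val, ord_inv,
      Units.val_zpow_eq_zpow_val, ord_zpow ϖ.ne_zero, hϖ]
    ring
  have h2 := norm_apply_unit hk hμ h
  rw [map_mul, map_inv, map_zpow, Units.val_mul, norm_mul, Units.val_inv_eq_inv_val, norm_inv,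
    Units.val_zpow_eq_zpow_val, norm_zpow] at h2
  rwa [mul_inv_eq_one₀] at h2
  exact zpow_ne_zero _ (norm_ne_zero_iff.2 (Units.ne_zero _))

/-! ### Unramified additive characters -/

omit [ValuativeRel F] [TopologicalSpace F] [IsNonarchimedeanLocalField F] in
theorem addChar_add_coe (ψ : AddChar F Circle) (x y : F) : (ψ (x + y) : ℂ) = ψ x * ψ y := by
  rw [AddChar.map_add_eq_mul, Circle.coe_mul]

theorem addChar_add_of_mem {ψ : AddChar F Circle} (hψ : IsUnramified ψ) (x : F) {s : F}
    (hs : s ∈ fracIdeal F 0) : ψ (x + s) = ψ x := by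
  rw [AddChar.map_add_eq_mul, hψ.1 s hs, mul_one]

theorem IsUnramified.continuous {ψ : AddChar F Circle} (hψ : IsUnramified ψ) : Continuous ψ :=
  continuous_of_translation_invariant 0 fun x _ hs => addChar_add_of_mem hψ x hs

section Measure

variable [MeasurableSpace F] [BorelSpace F] {dm : Measure F} [dm.IsAddHaarMeasure]

theorem integral_eq_zero_of_add_eq_mul {f : F → ℂ} (s : F) {c : ℂ} (hc : c ≠ 1)
    (h : ∀ m, f (m + s) = c * f m) : ∫ m, f m ∂dm = 0 := by
  have h1 := integral_add_right_eq_self (μ := dm) f s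
  simp_rw [h] at h1
  rw [integral_const_mul] at h1
  by_contra h0
  exact hc ((mul_eq_right₀ h0).1 h1)

omit [dm.IsAddHaarMeasure] in
theorem integral_indicator_integers (h1 : dm (fracIdeal F 0) = 1) :
    ∫ x, (fracIdeal F 0).indicator (1 : F → ℂ) x ∂dm = 1 := by
  rw [integral_indicator (measurableSet_fracIdeal 0)]
  simp [Measure.real, h1]

/-- Orthogonality: the Fourier transform of the indicator function of `O` is itself. -/
theorem integral_addChar_mul {ψ : AddChar F Circle} (hψ : IsUnramified ψ)
    (h1 : dm (fracIdeal F 0) = 1) (y : F) :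
    ∫ x, (fracIdeal F 0).indicator (fun x => (ψ (x * y) : ℂ)) x ∂dm =
      (fracIdeal F 0).indicator 1 y := by
  by_cases hy : y ∈ fracIdeal F 0
  · have h : (fracIdeal F 0).indicator (fun x => (ψ (x * y) : ℂ)) =
        (fracIdeal F 0).indicator 1 := by
      refine Set.indicator_congr fun x hx => ?_
      rw [hψ.1 _ (by simpa using mul_mem_fracIdeal hx hy)]
      simp
    rw [h, integral_indicator_integers h1, Set.indicator_of_mem hy]
    rfl
  · rw [Set.indicator_of_notMem hy]
    obtain ⟨z, hz, hz1⟩ := hψ.2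
    have hy0 : y ≠ 0 := by rintro rfl; simp at hy
    rw [mem_fracIdeal_iff_of_ne hy0] at hy
    have hs : z / y ∈ fracIdeal F 0 := by
      rw [div_eq_mul_inv]
      refine fracIdeal_anti ?_ (mul_mem_fracIdeal hz (mem_fracIdeal_ord y⁻¹))
      rw [ord_inv]
      omega
    refine integral_eq_zero_of_add_eq_mul (z / y) (c := ψ z)
      (fun h => hz1 (Circle.ext h)) fun m => ?_
    by_cases hm : m ∈ fracIdeal F 0
    · rw [Set.indicator_of_mem (add_mem_fracIdeal hm hs), Set.indicator_of_mem hm, add_mul,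
        div_mul_cancel₀ _ hy0, addChar_add_coe, mul_comm]
    · rw [Set.indicator_of_notMem hm, Set.indicator_of_notMem, mul_zero]
      intro h
      exact hm (by simpa using sub_mem_fracIdeal h hs)

/-! ### Gauss sums -/

/-- The Gauss sum `∫ μ(m) ψ(x m) dm` over the shell `v m = -k`. -/
noncomputable def gaussSum (dm : Measure F) (ψ : AddChar F Circle) (μ : Fˣ →* ℂˣ) (k : ℕ)
    (x : F) : ℂ :=
  ∫ m, shellChar μ (-k) m * ψ (x * m) ∂dm

theorem mul_gaussSum_mul_unit (ψ : AddChar F Circle) (μ : Fˣ →* ℂˣ) (k : ℕ) (x : F) {u : Fˣ}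
    (hu : ord (u : F) = 0) : μ u * gaussSum dm ψ μ k (x * u) = gaussSum dm ψ μ k x := by
  have h := (measurePreserving_unit_mul (dm := dm) hu).integral_comp
    (Homeomorph.mulLeft₀ (u : F) u.ne_zero).measurableEmbedding
    (fun m => shellChar μ (-k) m * (ψ (x * m) : ℂ))
  rw [gaussSum, gaussSum, ← integral_const_mul, ← h]
  refine integral_congr_ae (ae_of_all _ fun m => ?_)
  simp only []
  rw [shellChar_unit_mul μ _ hu, mul_assoc, mul_assoc]

theorem gaussSum_eq_zero {ψ : AddChar F Circle} (hψ : IsUnramified ψ) {μ : Fˣ →* ℂˣ} {k : ℕ}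
    (hk : 1 ≤ k) (hμ : HasLevel μ k) {x : F} (hx : x ∈ fracIdeal F 1) :
    gaussSum dm ψ μ k x = 0 := by
  obtain ⟨u, hu, hu1⟩ := hμ.2 (k - 1) (by omega)
  rw [mem_unitGroup_iff] at hu
  have h := mul_gaussSum_mul_unit (dm := dm) ψ μ k x hu.1
  have h2 : gaussSum dm ψ μ k (x * u) = gaussSum dm ψ μ k x := by
    refine integral_congr_ae (ae_of_all _ fun m => ?_)
    simp only []
    by_cases hm : m ≠ 0 ∧ ord m = -(k : ℤ)
    · have h3 : x * u * m = x * m + x * ((u - 1) * m) := by ring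
      rw [h3, addChar_add_of_mem hψ]
      have h4 := mul_mem_fracIdeal hx (mul_mem_fracIdeal hu.2 (mem_fracIdeal_ord m))
      rw [hm.2] at h4
      exact fracIdeal_anti (by omega) h4
    · simp [shellChar_of_not μ hm]
  rw [h2] at h
  by_contra h0
  exact hu1 (Units.ext ((mul_eq_right₀ h0).1 h))

theorem norm_gaussSum_le {ψ : AddChar F Circle} (hψ : IsUnramified ψ) {μ : Fˣ →* ℂˣ} {k : ℕ}
    (hk : 1 ≤ k) (hμ : HasLevel μ k) {x : F} (hx : x ∈ fracIdeal F 0) :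
    ‖gaussSum dm ψ μ k x‖ ≤ ‖gaussSum dm ψ μ k (-1)‖ := by
  by_cases h1 : x ∈ fracIdeal F 1
  · rw [gaussSum_eq_zero hψ hk hμ h1, norm_zero]
    positivity
  have hx0 : x ≠ 0 := by rintro rfl; simp at h1
  rw [mem_fracIdeal_iff_of_ne hx0] at hx h1
  have hu : ord ((Units.mk0 (-x) (neg_ne_zero.2 hx0) : Fˣ) : F) = 0 := by
    rw [Units.val_mk0, ord_neg]
    omega
  rw [← mul_gaussSum_mul_unit (dm := dm) ψ μ k (-1) hu, norm_mul, norm_apply_unit hk hμ.1 hu,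
    one_mul, Units.val_mk0, neg_one_mul, neg_neg]

/-- Lower bound for the Gauss sum of a character whose level matches the shell, by Fourier
inversion: the transform of `gaussSum` over `O`, evaluated at `ϖ ^ (-k)`, returns `μ(ϖ ^ (-k))`. -/
theorem norm_gaussSum_ge {ψ : AddChar F Circle} (hψ : IsUnramified ψ) {μ : Fˣ →* ℂˣ} {k : ℕ}
    (hk : 1 ≤ k) (hμ : HasLevel μ k) {ϖ : Fˣ} (hϖ : ord (ϖ : F) = 1)
    (h1 : dm (fracIdeal F 0) = 1) :
    1 ≤ ‖(μ ϖ : ℂ)‖ ^ k * ‖gaussSum dm ψ μ k (-1)‖ := by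
  set y : Fˣ := (ϖ ^ k)⁻¹ with hy
  have hyord : ord (y : F) = -k := by
    rw [hy, Units.val_inv_eq_inv_val, ord_inv, Units.val_pow_eq_pow_val, ord_pow ϖ.ne_zero, hϖ,
      mul_one]
  let f : F → F → ℂ := fun x m =>
    (fracIdeal F 0).indicator (fun x => (ψ (x * (m - y)) : ℂ)) x * shellChar μ (-k) m
  have hswap : ∫ x, ∫ m, f x m ∂dm ∂dm = ∫ m, ∫ x, f x m ∂dm ∂dm := by
    refine integral_integral_swap_of_hasCompactSupport ?_ ?_
    · refine Continuous.mul ?_ ((continuous_shellChar hk hμ.1 _).comp continuous_snd)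
      have h2 : Continuous ((fracIdeal F 0).indicator (1 : F → ℂ)) :=
        continuous_of_translation_invariant 0 fun x s hs => by
          by_cases hx : x ∈ fracIdeal F 0
          · rw [Set.indicator_of_mem hx, Set.indicator_of_mem (add_mem_fracIdeal hx hs)]
            rfl
          · rw [Set.indicator_of_notMem hx, Set.indicator_of_notMem]
            intro h
            exact hx (by simpa using sub_mem_fracIdeal h hs)
      have h3 : Continuous fun q : F × F => (ψ (q.1 * (q.2 - y)) : ℂ) :=
        continuous_induced_dom.comp (hψ.continuous.comp (by fun_prop))
      convert (h2.comp continuous_fst).mul h3 using 1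
      ext q
      by_cases hq : q.1 ∈ fracIdeal F 0 <;> simp [hq]
    · refine HasCompactSupport.of_support_subset_isCompact
        ((isCompact_fracIdeal 0).prod (isCompact_fracIdeal (-k))) fun q hq => ?_
      refine ⟨?_, ?_⟩
      · by_contra h
        exact hq (by simp [f, Function.uncurry, h])
      · by_contra h
        refine hq ?_
        simp only [f, Function.uncurry]
        rw [shellChar_of_not, mul_zero]
        rintro ⟨h2, h3⟩
        exact h ((mem_fracIdeal_iff_of_ne h2).2 h3.ge)
  have hright : ∫ m, ∫ x, f x m ∂dm ∂dm = μ y := by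
    simp only [f, integral_mul_const, integral_addChar_mul hψ h1]
    have h2 : ∀ m, (fracIdeal F 0).indicator (1 : F → ℂ) (m - y) * shellChar μ (-k) m =
        (fracIdeal F 0).indicator (1 : F → ℂ) (m - y) * μ y := by
      intro m
      by_cases hm : m - y ∈ fracIdeal F 0
      · have h3 := shellChar_add hk hμ.1 (n := -(k : ℤ)) (y : F) (s := m - y) (by simpa using hm)
        rw [add_sub_cancel, shellChar_of_ord μ hyord] at h3
        rw [h3]
      · simp [hm]
    simp_rw [h2]
    rw [integral_mul_const, integral_sub_right_eq_self
      (fun m => (fracIdeal F 0).indicator (1 : F → ℂ) m),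
      integral_indicator_integers h1, one_mul]
  have hleft : ‖∫ x, ∫ m, f x m ∂dm ∂dm‖ ≤ ‖gaussSum dm ψ μ k (-1)‖ := by
    have h2 : ∀ x, ∫ m, f x m ∂dm = (fracIdeal F 0).indicator
        (fun x => (ψ (-(x * y)) : ℂ) * gaussSum dm ψ μ k x) x := by
      intro x
      by_cases hx : x ∈ fracIdeal F 0
      · simp only [f, Set.indicator_of_mem hx]
        rw [gaussSum, ← integral_const_mul]
        refine integral_congr_ae (ae_of_all _ fun m => ?_)
        simp only []
        rw [mul_sub, sub_eq_add_neg, addChar_add_coe]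
        ring
      · simp [f, Set.indicator_of_notMem hx]
    simp_rw [h2]
    rw [integral_indicator (measurableSet_fracIdeal 0)]
    refine (norm_setIntegral_le_of_norm_le_const (measure_fracIdeal_lt_top dm 0)
      (C := ‖gaussSum dm ψ μ k (-1)‖) fun x hx => ?_).trans_eq ?_
    · rw [norm_mul, Circle.norm_coe, one_mul]
      exact norm_gaussSum_le hψ hk hμ hx
    · rw [Measure.real, h1, ENNReal.toReal_one, mul_one]
  rw [hswap, hright, norm_apply_eq_zpow hk hμ.1 hϖ, hyord, zpow_neg, zpow_natCast] at hleft
  exact (inv_le_iff_one_le_mul₀' (pow_pos (norm_pos_iff.2 (Units.ne_zero _)) _)).1 hleft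

end Measure

/-! ### The newform in the induced model -/

omit [ValuativeRel F] [TopologicalSpace F] [IsNonarchimedeanLocalField F] in
@[simp] theorem coe_upper (a : Fˣ) (b : F) (d : Fˣ) :
    (upper a b d : Matrix (Fin 2) (Fin 2) F) = !![(a : F), b; 0, (d : F)] := rfl

omit [ValuativeRel F] [TopologicalSpace F] [IsNonarchimedeanLocalField F] in
@[simp] theorem coe_lower (x : F) :
    (lower x : Matrix (Fin 2) (Fin 2) F) = !![1, 0; x, 1] := rfl

variable (F) in
omit [ValuativeRel F] [TopologicalSpace F] [IsNonarchimedeanLocalField F] in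
@[simp] theorem coe_weyl : (weyl F : Matrix (Fin 2) (Fin 2) F) = !![0, 1; -1, 0] := rfl

theorem nabs_one : nabs (1 : F) = 1 := nabs_eq_one_iff.2 ⟨one_ne_zero, ord_one⟩

theorem lower_mem_K1 {c : ℕ} {s : F} (hs : s ∈ fracIdeal F c) : lower s ∈ K1 F c := by
  have h1 : (1 : F) ∈ fracIdeal F 0 := by simp [mem_fracIdeal_iff]
  refine ⟨fun i j => ?_, ?_, ?_, ?_⟩
  · fin_cases i <;> fin_cases j <;> simp [h1]
    exact fracIdeal_anti (by omega) hs
  · simp [Matrix.det_fin_two, nabs_one]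
  · simpa using hs
  · simp

theorem upper_mem_K1 (c : ℕ) {u : Fˣ} (hu : ord (u : F) = 0) {b : F} (hb : b ∈ fracIdeal F 0) :
    upper u b 1 ∈ K1 F c := by
  have h1 : (1 : F) ∈ fracIdeal F 0 := by simp [mem_fracIdeal_iff]
  have h2 : (u : F) ∈ fracIdeal F 0 := by simp [mem_fracIdeal_iff, hu]
  refine ⟨fun i j => ?_, ?_, ?_, ?_⟩
  · fin_cases i <;> fin_cases j <;> simp [h1, h2, hb]
  · simp [Matrix.det_fin_two, nabs_eq_one_iff, hu]
  · simp
  · simp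

section Newform

variable {μ₁ μ₂ : Fˣ →* ℂˣ} {k : ℕ} {φ : GL (Fin 2) F → ℂ}

theorem IsFixedVector.apply_lower_mul_unit {c : ℕ} (hφ : IsFixedVector μ₁ μ₂ c φ) (x : F) {u : Fˣ}
    (hu : ord (u : F) = 0) : φ (lower x) = μ₁ u * φ (lower (x * u)) := by
  have h : lower x * upper u 0 1 = upper u 0 1 * lower (x * u) := by
    ext i j
    fin_cases i <;> fin_cases j <;> simp [Matrix.mul_apply]
  rw [← hφ.invariant _ _ (upper_mem_K1 c hu (zero_mem_fracIdeal 0)), h, hφ.equivariant,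
    nabs_eq_one_iff.2 ⟨u.ne_zero, hu⟩]
  simp [nabs_one]

theorem IsFixedVector.apply_lower_add {c : ℕ} (hφ : IsFixedVector μ₁ μ₂ c φ) (x : F) {s : F}
    (hs : s ∈ fracIdeal F c) : φ (lower (x + s)) = φ (lower x) := by
  have h : lower x * lower s = lower (x + s) := by
    ext i j
    fin_cases i <;> fin_cases j <;> simp [Matrix.mul_apply]
  rw [← h, hφ.invariant _ _ (lower_mem_K1 hs)]

theorem IsFixedVector.apply_lower_eq_unipotent {c : ℕ} (hφ : IsFixedVector μ₁ μ₂ c φ) (x : F)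
    {b : F} (hb : b ∈ fracIdeal F 0) (d : Fˣ) (hd : (d : F) = 1 + b * x) :
    φ (lower x) = μ₁ d⁻¹ * μ₂ d * (Real.sqrt (nabs ((d⁻¹ : Fˣ) : F) / nabs (d : F)) : ℂ) *
      φ (lower (x * (d⁻¹ : Fˣ))) := by
  have h : lower x * upper 1 b 1 = upper d⁻¹ b d * lower (x * (d⁻¹ : Fˣ)) := by
    have h0 := d.ne_zero
    ext i j
    fin_cases i <;> fin_cases j <;> simp [Matrix.mul_apply]
    · field_simp
      exact hd
    · field_simp
    · rw [hd]; ring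
  rw [← hφ.invariant _ _ (upper_mem_K1 c (u := 1) ord_one hb), h, hφ.equivariant]

/-- The newform vanishes at `lower x` unless `v x = k`: for smaller `v x` because `μ₂` has
level `k`, for larger `v x` because `μ₁` has level `k`. -/
theorem IsFixedVector.ord_eq_of_apply_lower_ne_zero (hφ : IsFixedVector μ₁ μ₂ (2 * k) φ)
    (hk : 1 ≤ k) (h₁ : HasLevel μ₁ k) (h₂ : HasLevel μ₂ k) {x : F} (hx : φ (lower x) ≠ 0) :
    x ≠ 0 ∧ ord x = k := by
  have c1 : ∀ u : Fˣ, ord (u : F) = 0 → x * (u - 1) ∈ fracIdeal F ((2 * k : ℕ) : ℤ) →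
      μ₁ u = 1 := by
    intro u hu h
    have e1 := hφ.apply_lower_mul_unit x hu
    have h3 : x * u = x + x * (u - 1) := by ring
    rw [h3, hφ.apply_lower_add x h] at e1
    exact Units.ext ((mul_eq_right₀ hx).1 e1.symm)
  have c2 : ∀ x : F, φ (lower x) ≠ 0 → x ≠ 0 → 0 ≤ ord x → k ≤ ord x := by
    intro x hx hx0 h0
    by_contra! hlt
    obtain ⟨u, hu, hu1⟩ := h₂.2 (ord x).toNat (by omega)
    rw [mem_unitGroup_iff] at hu
    have hb : ((u : F) - 1) * x⁻¹ ∈ fracIdeal F 0 := by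
      have := mul_mem_fracIdeal hu.2 (mem_fracIdeal_ord x⁻¹)
      rw [ord_inv] at this
      exact fracIdeal_anti (by omega) this
    have hi : ord ((u⁻¹ : Fˣ) : F) = 0 := by simp [hu.1]
    have e1 := hφ.apply_lower_eq_unipotent x hb u (by
      rw [mul_assoc, inv_mul_cancel₀ hx0]
      ring)
    have e2 := hφ.apply_lower_mul_unit x hi
    rw [nabs_eq_one_iff.2 ⟨Units.ne_zero _, hi⟩, nabs_eq_one_iff.2 ⟨Units.ne_zero _, hu.1⟩] at e1
    have e3 : φ (lower x) = μ₂ u * φ (lower x) := by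
      nth_rw 1 [e1]
      rw [e2]
      simp
      ring
    exact hu1 (Units.ext ((mul_eq_right₀ hx).1 e3.symm))
  have hx0 : x ≠ 0 := by
    rintro rfl
    obtain ⟨u, hu, hu1⟩ := h₁.2 0 (by omega)
    exact hu1 (c1 u (mem_unitGroup_iff.1 hu).1 (by simp))
  refine ⟨hx0, ?_⟩
  rcases lt_or_ge (ord x) 0 with hneg | hnn
  · have h1 : (1 : F) ∈ fracIdeal F (ord x + 1) := by
      rw [mem_fracIdeal_iff_of_ne one_ne_zero, ord_one]
      omega
    obtain ⟨hd0, hd⟩ := ord_add_of_mem hx0 h1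
    have e1 := hφ.apply_lower_eq_unipotent x (b := 1) (by simp [mem_fracIdeal_iff])
      (Units.mk0 _ hd0) (by rw [Units.val_mk0]; ring)
    have hne := right_ne_zero_of_mul (e1 ▸ hx)
    have hord : ord (x * ((Units.mk0 _ hd0)⁻¹ : Fˣ)) = 0 := by
      rw [ord_mul hx0 (Units.ne_zero _), Units.val_inv_eq_inv_val, ord_inv, Units.val_mk0, hd]
      ring
    have := c2 _ hne (mul_ne_zero hx0 (Units.ne_zero _)) hord.ge
    omega
  · refine le_antisymm ?_ (c2 x hx hx0 hnn)
    by_contra! hlt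
    obtain ⟨u, hu, hu1⟩ := h₁.2 (2 * k - ord x).toNat (by omega)
    rw [mem_unitGroup_iff] at hu
    exact hu1 (c1 u hu.1 (fracIdeal_anti (by push_cast; omega)
      (mul_mem_fracIdeal (mem_fracIdeal_ord x) hu.2)))

theorem IsFixedVector.norm_apply_lower {c : ℕ} (hφ : IsFixedVector μ₁ μ₂ c φ) (hk : 1 ≤ k)
    (h₁ : HasLevel μ₁ k) {x y : Fˣ} (h : ord (x : F) = ord (y : F)) :
    ‖φ (lower (x : F))‖ = ‖φ (lower (y : F))‖ := by
  have hu : ord ((x⁻¹ * y : Fˣ) : F) = 0 := by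
    rw [Units.val_mul, ord_mul (Units.ne_zero _) y.ne_zero, Units.val_inv_eq_inv_val, ord_inv, h]
    ring
  rw [hφ.apply_lower_mul_unit x hu, norm_mul, norm_apply_unit hk h₁.1 hu, one_mul,
    ← Units.val_mul, mul_inv_cancel_left]

/-! ### The Whittaker integrand -/

/-- The value of `φ` entering the Whittaker integral at `diag(a, 1) * lower z`. -/
noncomputable def orbitValue (φ : GL (Fin 2) F → ℂ) (a : Fˣ) (z m : F) : ℂ :=
  φ (weyl F * upper 1 m 1 * (upper a 0 1 * lower z))

/-- The Iwasawa-type decomposition of the argument of `φ` in the Whittaker integral. -/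
theorem IsFixedVector.orbitValue_eq {c : ℕ} (hφ : IsFixedVector μ₁ μ₂ c φ) (a : Fˣ) (z : F)
    (m : Fˣ) :
    orbitValue φ a z m = μ₁ (-a * m⁻¹) * μ₂ (-m) *
      (Real.sqrt (nabs ((-a * m⁻¹ : Fˣ) : F) / nabs ((-m : Fˣ) : F)) : ℂ) *
        φ (lower (z + a * (m⁻¹ : Fˣ))) := by
  have h : weyl F * upper 1 (m : F) 1 * (upper a 0 1 * lower z) =
      upper (-a * m⁻¹) 1 (-m) * lower (z + a * (m⁻¹ : Fˣ)) := by
    have h0 := m.ne_zero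
    ext i j
    fin_cases i <;> fin_cases j <;> simp [Matrix.mul_apply]
    field_simp
    ring
  rw [orbitValue, h, hφ.equivariant]

theorem IsFixedVector.orbitValue_add {c : ℕ} (hφ : IsFixedVector μ₁ μ₂ (2 * c) φ) (a : Fˣ)
    {z : F} (hz : z ∈ fracIdeal F c) (m : F) {s : F}
    (hs : s ∈ fracIdeal F (2 * c + ord (a : F))) :
    orbitValue φ a z (m + s) = orbitValue φ a z m := by
  obtain ⟨b, rfl⟩ : ∃ b, s = a * b := ⟨(a : F)⁻¹ * s, by rw [mul_inv_cancel_left₀ a.ne_zero]⟩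
  rw [mul_mem_fracIdeal_add_ord_iff a.ne_zero] at hs
  have hbz : b * z ∈ fracIdeal F (2 * c) := fracIdeal_anti (by omega) (mul_mem_fracIdeal hs hz)
  have hbzz : b * z * z ∈ fracIdeal F (2 * c) :=
    fracIdeal_anti (by omega) (mul_mem_fracIdeal hbz hz)
  have h1 : (1 : F) ∈ fracIdeal F 0 := by simp [mem_fracIdeal_iff]
  have h0 : fracIdeal F (2 * c) ⊆ fracIdeal F 0 := fracIdeal_anti (by omega)
  have hκ : lower (-z) * (upper 1 b 1 * lower z) ∈ K1 F (2 * c) := by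
    have e : ((lower (-z) * (upper 1 b 1 * lower z) : GL (Fin 2) F) : Matrix (Fin 2) (Fin 2) F) =
        !![1 + b * z, b; -(b * z * z), 1 - b * z] := by
      ext i j
      fin_cases i <;> fin_cases j <;> simp [Matrix.mul_apply] <;> ring
    refine ⟨fun i j => ?_, ?_, ?_, ?_⟩
    · rw [e]
      fin_cases i <;> fin_cases j
      · exact add_mem_fracIdeal h1 (h0 hbz)
      · exact h0 hs
      · exact neg_mem_fracIdeal (h0 hbzz)
      · exact sub_mem_fracIdeal h1 (h0 hbz)
    · rw [e, Matrix.det_fin_two_of, show (1 + b * z) * (1 - b * z) - b * -(b * z * z) = 1 by ring,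
        nabs_one]
    · rw [e]
      exact_mod_cast neg_mem_fracIdeal hbzz
    · rw [e]
      have : (1 - b * z) - 1 ∈ fracIdeal F (2 * c) := by
        rw [sub_sub_cancel_left]
        exact neg_mem_fracIdeal hbz
      exact_mod_cast this
  have h : weyl F * upper 1 (m + a * b) 1 * (upper a 0 1 * lower z) =
      weyl F * upper 1 m 1 * (upper a 0 1 * lower z) * (lower (-z) * (upper 1 b 1 * lower z)) := by
    ext i j
    fin_cases i <;> fin_cases j <;> simp [Matrix.mul_apply] <;> ring
  rw [orbitValue, h, hφ.invariant _ _ hκ, orbitValue]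

theorem IsFixedVector.orbitValue_zero (hφ : IsFixedVector μ₁ μ₂ (2 * k) φ)
    (hk : 1 ≤ k) (h₁ : HasLevel μ₁ k) (h₂ : HasLevel μ₂ k) {ϖ : Fˣ} (hϖ : ord (ϖ : F) = 1)
    (a : Fˣ) {z : F} (hz : z ∈ fracIdeal F k) : orbitValue φ a z 0 = 0 := by
  -- By translation invariance `0` may be replaced by a nonzero point close to it.
  have hord : ord ((a * ϖ ^ (2 * k) : Fˣ) : F) = 2 * k + ord (a : F) := by
    rw [Units.val_mul, ord_mul a.ne_zero (Units.ne_zero _), Units.val_pow_eq_pow_val,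
      ord_pow ϖ.ne_zero, hϖ]
    push_cast
    ring
  have h := hφ.orbitValue_add a hz 0 (hord ▸ mem_fracIdeal_ord ((a * ϖ ^ (2 * k) : Fˣ) : F))
  rw [← h, zero_add, hφ.orbitValue_eq]
  by_contra h0
  obtain ⟨hx, hx'⟩ := hφ.ord_eq_of_apply_lower_ne_zero hk h₁ h₂ (right_ne_zero_of_mul h0)
  have hy : ord ((a : F) * ((a * ϖ ^ (2 * k))⁻¹ : Fˣ)) = -(2 * k) := by
    rw [ord_mul a.ne_zero (Units.ne_zero _), Units.val_inv_eq_inv_val, ord_inv, hord]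
    ring
  have h3 := ord_add_of_mem (mul_ne_zero a.ne_zero (Units.ne_zero (a * ϖ ^ (2 * k))⁻¹))
    (fracIdeal_anti (by omega) hz)
  rw [add_comm] at h3
  omega

/-- On the support of the integrand, the argument `z + a / m` has valuation `k`. -/
theorem IsFixedVector.ord_of_orbitValue_ne_zero (hφ : IsFixedVector μ₁ μ₂ (2 * k) φ)
    (hk : 1 ≤ k) (h₁ : HasLevel μ₁ k) (h₂ : HasLevel μ₂ k) {a m : Fˣ} {z : F}
    (h : orbitValue φ a z m ≠ 0) :
    z + a * (m⁻¹ : Fˣ) ≠ 0 ∧ ord (z + a * (m⁻¹ : Fˣ)) = k := by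
  rw [hφ.orbitValue_eq] at h
  exact hφ.ord_eq_of_apply_lower_ne_zero hk h₁ h₂ (right_ne_zero_of_mul h)

theorem sqrt_nabs_div (a m : Fˣ) :
    Real.sqrt (nabs ((-a * m⁻¹ : Fˣ) : F) / nabs ((-m : Fˣ) : F)) =
      (resCard F : ℝ) ^ (-(ord (a : F) : ℝ) / 2) * (resCard F : ℝ) ^ ord (m : F) := by
  have hp := resCard_pos F
  rw [nabs_eq (Units.ne_zero _), nabs_eq (Units.ne_zero _),
    Real.sqrt_eq_iff_mul_self_eq (by positivity) (by positivity),
    ← Real.rpow_intCast, ← Real.rpow_intCast, ← Real.rpow_intCast,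
    ← Real.rpow_sub hp, ← Real.rpow_add hp, ← Real.rpow_add hp]
  congr 1
  rw [Units.val_mul, ord_mul (Units.ne_zero _) (Units.ne_zero _), Units.val_neg, Units.val_neg,
    ord_neg, ord_neg, Units.val_inv_eq_inv_val, ord_inv]
  push_cast
  ring

theorem IsFixedVector.norm_orbitValue_le (hφ : IsFixedVector μ₁ μ₂ (2 * k) φ)
    (hk : 1 ≤ k) (h₁ : HasLevel μ₁ k) (h₂ : HasLevel μ₂ k) {ϖ : Fˣ} (hϖ : ord (ϖ : F) = 1)
    (a m : Fˣ) (z : F) :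
    ‖orbitValue φ a z m‖ ≤ ‖(μ₁ ϖ : ℂ)‖ ^ (ord (a : F) - ord (m : F)) *
      ‖(μ₂ ϖ : ℂ)‖ ^ ord (m : F) * ((resCard F : ℝ) ^ (-(ord (a : F) : ℝ) / 2) *
        (resCard F : ℝ) ^ ord (m : F)) * ‖φ (lower ((ϖ : F) ^ k))‖ := by
  have hp := resCard_pos F
  by_cases h : orbitValue φ a z m = 0
  · rw [h, norm_zero]
    positivity
  obtain ⟨hx, hx'⟩ := hφ.ord_of_orbitValue_ne_zero hk h₁ h₂ h
  have hk' : ord ((ϖ ^ k : Fˣ) : F) = k := by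
    rw [Units.val_pow_eq_pow_val, ord_pow ϖ.ne_zero, hϖ, mul_one]
  have e := hφ.norm_apply_lower hk h₁ (x := Units.mk0 _ hx) (y := ϖ ^ k) (hx'.trans hk'.symm)
  rw [Units.val_mk0, Units.val_pow_eq_pow_val] at e
  rw [hφ.orbitValue_eq, norm_mul, norm_mul, norm_mul, norm_apply_eq_zpow hk h₁.1 hϖ,
    norm_apply_eq_zpow hk h₂.1 hϖ, Complex.norm_real, Real.norm_of_nonneg (Real.sqrt_nonneg _),
    sqrt_nabs_div, e, Units.val_mul, ord_mul (Units.ne_zero _) (Units.ne_zero _), Units.val_neg,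
    Units.val_neg, ord_neg, ord_neg, Units.val_inv_eq_inv_val, ord_inv, ← sub_eq_add_neg]

/-- Replacing `m` by `m (1 + t)` with `v t ≥ k` does not change the integrand, apart from the
additive character. -/
theorem IsFixedVector.orbitValue_add_of_ord (hφ : IsFixedVector μ₁ μ₂ (2 * k) φ)
    (hk : 1 ≤ k) (h₁ : HasLevel μ₁ k) (h₂ : HasLevel μ₂ k) {z : F} (hz : z ∈ fracIdeal F k)
    (a m : Fˣ) {s : F} (hs : s ∈ fracIdeal F (ord (m : F) + k)) :
    orbitValue φ a z (m + s) = orbitValue φ a z m := by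
  have key : ∀ (m u : Fˣ), u ∈ unitGroup F k → orbitValue φ a z m ≠ 0 →
      orbitValue φ a z (m * u : Fˣ) = orbitValue φ a z m := by
    intro m u hu h
    obtain ⟨hx, hx'⟩ := hφ.ord_of_orbitValue_ne_zero hk h₁ h₂ h
    obtain ⟨hu0, hu1⟩ := mem_unitGroup_iff.1 hu
    obtain ⟨w, hw, hwe⟩ := exists_unitGroup_mul_eq_add hk (Units.mk0 _ hx) (s := z * (u - 1))
      (by rw [Units.val_mk0, hx']; exact mul_mem_fracIdeal hz hu1)
    have hmu : ord ((m * u : Fˣ) : F) = ord (m : F) := by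
      rw [Units.val_mul, ord_mul m.ne_zero u.ne_zero, hu0, add_zero]
    have hwu : ord ((w⁻¹ * u : Fˣ) : F) = 0 := by
      rw [Units.val_mul, ord_mul (Units.ne_zero _) u.ne_zero, Units.val_inv_eq_inv_val, ord_inv,
        (mem_unitGroup_iff.1 hw).1, hu0]
      simp
    have hz' : (z + a * ((m * u)⁻¹ : Fˣ)) * (w⁻¹ * u : Fˣ) = z + a * (m⁻¹ : Fˣ) := by
      have e0 := u.ne_zero
      have e1 := m.ne_zero
      have e2 := w.ne_zero
      rw [Units.val_mk0, Units.val_mul, Units.val_mk0] at hwe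
      simp only [Units.val_mul, Units.val_inv_eq_inv_val] at hwe ⊢
      field_simp at hwe ⊢
      linear_combination hwe
    rw [hφ.orbitValue_eq, hφ.orbitValue_eq, sqrt_nabs_div, sqrt_nabs_div, hmu,
      hφ.apply_lower_mul_unit (z + a * ((m * u)⁻¹ : Fˣ)) hwu, hz', map_mul μ₁ w⁻¹ u, map_inv,
      h₁.1 w hw, h₁.1 u hu, neg_mul_eq_neg_mul m u, map_mul μ₂ (-m) u, h₂.1 u hu, mul_inv m u,
      ← mul_assoc (-a), map_mul μ₁ _ u⁻¹, map_inv, h₁.1 u hu]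
    simp
  obtain ⟨u, hu, hmu⟩ := exists_unitGroup_mul_eq_add hk m hs
  rw [hmu]
  by_cases h : orbitValue φ a z m = 0
  · by_contra h'
    rw [h] at h'
    have hinv : u⁻¹ ∈ unitGroup F k := by
      obtain ⟨hu0, hu1⟩ := mem_unitGroup_iff.1 hu
      refine mem_unitGroup_iff.2 ⟨by simp [hu0], ?_⟩
      have e : ((u⁻¹ : Fˣ) : F) - 1 = -((u : F)⁻¹ * (u - 1)) := by
        rw [Units.val_inv_eq_inv_val, mul_sub, inv_mul_cancel₀ u.ne_zero]
        ring
      rw [e]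
      have := mul_mem_fracIdeal (mem_fracIdeal_ord (u : F)⁻¹) hu1
      rw [ord_inv, hu0, neg_zero, zero_add] at this
      exact neg_mem_fracIdeal this
    have := key _ _ hinv h'
    rw [mul_inv_cancel_right, h] at this
    exact h' this.symm
  · exact key m u hu h

end Newform

/-! ### The Whittaker integral -/

section Newform

variable {μ₁ μ₂ : Fˣ →* ℂˣ} {k : ℕ} {φ : GL (Fin 2) F → ℂ}

/-- The Whittaker integrand is locally constant, uniformly on `F`. -/
theorem IsFixedVector.continuous_integrand {c : ℕ} (hφ : IsFixedVector μ₁ μ₂ (2 * c) φ) (a : Fˣ)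
    {z : F} (hz : z ∈ fracIdeal F c) {ψ : AddChar F Circle} (hψ : IsUnramified ψ) :
    Continuous fun m => orbitValue φ a z m * (ψ (-m) : ℂ) :=
  (continuous_of_translation_invariant _ fun m _ hs => hφ.orbitValue_add a hz m hs).mul
    (continuous_induced_dom.comp (hψ.continuous.comp continuous_neg))

variable [MeasurableSpace F] [BorelSpace F] {dm : Measure F} [dm.IsAddHaarMeasure]

/-- The normalization `W(1) = 1` bounds the newform at `lower (ϖ ^ k)`, since `W(1)` is this value
times a Gauss sum of `μ₂`. -/
theorem norm_apply_lower_le_of_normalized (hφ : IsFixedVector μ₁ μ₂ (2 * k) φ)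
    (hk : 1 ≤ k) (h₁ : HasLevel μ₁ k) (h₂ : HasLevel μ₂ k) {ϖ : Fˣ} (hϖ : ord (ϖ : F) = 1)
    (hdm : dm (fracIdeal F 0) = 1) {ψ : AddChar F Circle} (hψ : IsUnramified ψ)
    {W : GL (Fin 2) F → ℂ} (hW : IsWhittakerTransform dm ψ φ W) (hW1 : W 1 = 1) :
    ‖(μ₁ ϖ : ℂ)‖ ^ k * ‖φ (lower ((ϖ : F) ^ k))‖ ≤ (resCard F : ℝ) ^ k * ‖(μ₂ ϖ : ℂ)‖ ^ k := by
  have hp := resCard_pos F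
  have hk' : ord ((ϖ ^ k : Fˣ) : F) = k := by
    rw [Units.val_pow_eq_pow_val, ord_pow ϖ.ne_zero, hϖ, mul_one]
  set c : ℂ := μ₁ (-1) * μ₂ (-1) * ((resCard F : ℝ) ^ (-(k : ℤ)) : ℝ) * μ₁ (ϖ ^ k) *
    φ (lower ((ϖ : F) ^ k)) with hc
  have hI : ∀ m, orbitValue φ 1 0 m * (ψ (-m) : ℂ) =
      c * (shellChar μ₂ (-k) m * (ψ (-1 * m) : ℂ)) := by
    intro m
    by_cases hm0 : m = 0
    · subst hm0
      rw [hφ.orbitValue_zero hk h₁ h₂ hϖ 1 (zero_mem_fracIdeal _), shellChar_of_not _ (by simp)]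
      simp
    lift m to Fˣ using IsUnit.mk0 m hm0
    by_cases hm : ord (m : F) = -k
    · have hu : ord ((m * ϖ ^ k : Fˣ) : F) = 0 := by
        rw [Units.val_mul, ord_mul m.ne_zero (Units.ne_zero _), hm, hk']
        ring
      have e := hφ.apply_lower_mul_unit (0 + (1 : Fˣ) * ((m⁻¹ : Fˣ) : F)) hu
      have e2 : (0 + ((1 : Fˣ) : F) * ((m⁻¹ : Fˣ) : F)) * ((m * ϖ ^ k : Fˣ) : F) = (ϖ : F) ^ k := by
        simp
      rw [e2] at e
      rw [hφ.orbitValue_eq, sqrt_nabs_div, e, shellChar_of_ord _ hm, hc, hm,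
        neg_one_mul (m : F), ← neg_one_mul m, map_mul μ₁ (-1), map_mul μ₁ m, map_mul μ₂, map_inv]
      simp
      field_simp
    · have h : orbitValue φ 1 0 m = 0 := by
        by_contra h
        have := (hφ.ord_of_orbitValue_ne_zero hk h₁ h₂ h).2
        rw [Units.val_one, one_mul, zero_add, Units.val_inv_eq_inv_val, ord_inv] at this
        omega
      rw [h, shellChar_of_not _ (by tauto)]
      simp
  have hone : (upper 1 0 1 * lower 0 : GL (Fin 2) F) = 1 := by
    ext i j
    fin_cases i <;> fin_cases j <;> simp [Matrix.mul_apply]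
  have hlim := hW 1
  rw [← hone] at hlim
  have hval : c * gaussSum dm ψ μ₂ k (-1) = 1 := by
    rw [← hW1, ← hone]
    refine tendsto_nhds_unique (tendsto_const_nhds.congr' ?_) hlim
    filter_upwards [eventually_ge_atTop k] with N hN
    change _ = ∫ m in fracIdeal F (-(N : ℤ)), orbitValue φ 1 0 m * (ψ (-m) : ℂ) ∂dm
    simp_rw [hI]
    rw [setIntegral_eq_integral_of_forall_compl_eq_zero, integral_const_mul, gaussSum]
    intro m hm
    rw [shellChar_of_not, zero_mul, mul_zero]
    rintro ⟨h0, h1⟩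
    exact hm ((mem_fracIdeal_iff_of_ne h0).2 (by omega))
  have hn : ord ((-1 : Fˣ) : F) = 0 := by simp
  have hcn : ‖c‖ = (resCard F : ℝ) ^ (-(k : ℤ)) * (‖(μ₁ ϖ : ℂ)‖ ^ k *
      ‖φ (lower ((ϖ : F) ^ k))‖) := by
    rw [hc]
    simp only [norm_mul]
    rw [norm_apply_unit hk h₁.1 hn, norm_apply_unit hk h₂.1 hn, Complex.norm_real,
      Real.norm_of_nonneg (by positivity), map_pow, Units.val_pow_eq_pow_val, norm_pow]
    ring
  have hg := norm_gaussSum_ge hψ hk h₂ hϖ hdm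
  have hv := congrArg norm hval
  rw [norm_mul, norm_one, hcn, zpow_neg, zpow_natCast] at hv
  set G := ‖gaussSum dm ψ μ₂ k (-1)‖
  set X := ‖(μ₁ ϖ : ℂ)‖ ^ k * ‖φ (lower ((ϖ : F) ^ k))‖
  have hX : 0 ≤ X := by positivity
  have hXG : X * G = (resCard F : ℝ) ^ k := by
    field_simp at hv
    exact hv
  calc X ≤ X * (‖(μ₂ ϖ : ℂ)‖ ^ k * G) := le_mul_of_one_le_right hX hg
    _ = X * G * ‖(μ₂ ϖ : ℂ)‖ ^ k := by ring
    _ = _ := by rw [hXG]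

/-- The Whittaker integral over a shell `v m = n` with `n < -k` vanishes: there the integrand is an
eigenfunction of translations by `ϖ ^ (-1)O` with the nontrivial eigencharacter `ψ⁻¹`. -/
theorem setIntegral_shell_eq_zero (hφ : IsFixedVector μ₁ μ₂ (2 * k) φ)
    (hk : 1 ≤ k) (h₁ : HasLevel μ₁ k) (h₂ : HasLevel μ₂ k) {ψ : AddChar F Circle}
    (hψ : IsUnramified ψ) (a : Fˣ) {z : F} (hz : z ∈ fracIdeal F k) {n : ℤ} (hn : n < -k) :
    ∫ m in fracIdeal F n \ fracIdeal F (n + 1), orbitValue φ a z m * (ψ (-m) : ℂ) ∂dm = 0 := by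
  obtain ⟨s, hs, hs1⟩ := hψ.2
  rw [← integral_indicator ((measurableSet_fracIdeal n).diff (measurableSet_fracIdeal (n + 1)))]
  refine integral_eq_zero_of_add_eq_mul (-s) (c := ψ s) (fun h => hs1 (Circle.ext h)) fun m => ?_
  have hs' := neg_mem_fracIdeal hs
  have hiff : ∀ j : ℤ, j ≤ n + 1 → (m + -s ∈ fracIdeal F j ↔ m ∈ fracIdeal F j) := by
    intro j hj
    have h := fracIdeal_anti (m := j) (by omega) hs'
    exact ⟨fun h2 => by simpa using sub_mem_fracIdeal h2 h, fun h2 => add_mem_fracIdeal h2 h⟩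
  by_cases hm : m ∈ fracIdeal F n \ fracIdeal F (n + 1)
  · have hm0 : m ≠ 0 := by
      rintro rfl
      exact hm.2 (zero_mem_fracIdeal _)
    have hm' : m + -s ∈ fracIdeal F n \ fracIdeal F (n + 1) :=
      ⟨(hiff n (by omega)).2 hm.1, (hiff (n + 1) le_rfl).not.2 hm.2⟩
    rw [Set.indicator_of_mem hm, Set.indicator_of_mem hm']
    lift m to Fˣ using IsUnit.mk0 m hm0
    have hord : ord (m : F) ≤ n := by
      have := hm.2
      rw [mem_fracIdeal_iff_of_ne hm0] at this
      omega
    rw [hφ.orbitValue_add_of_ord hk h₁ h₂ hz a m (fracIdeal_anti (by omega) hs'), neg_add, neg_neg,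
      addChar_add_coe]
    ring
  · rw [Set.indicator_of_notMem hm, Set.indicator_of_notMem, mul_zero]
    exact fun h => hm ⟨(hiff n (by omega)).1 h.1, fun h2 => h.2 ((hiff (n + 1) le_rfl).2 h2)⟩

/-- On a shell `v m = n` with `-k ≤ n ≤ v a - k` the Whittaker integral is bounded independently
of `n`: the volume of the shell cancels `|m|⁻¹`, and the exponents of `|μ₁(ϖ)|` and `|μ₂(ϖ)|` are
nonnegative with sum `v a`. -/
theorem norm_setIntegral_shell_le (hφ : IsFixedVector μ₁ μ₂ (2 * k) φ)
    (hk : 1 ≤ k) (h₁ : HasLevel μ₁ k) (h₂ : HasLevel μ₂ k) {ϖ : Fˣ} (hϖ : ord (ϖ : F) = 1)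
    (hdm : dm (fracIdeal F 0) = 1) (ψ : AddChar F Circle) (a : Fˣ) (z : F)
    (hnorm : ‖(μ₁ ϖ : ℂ)‖ ^ k * ‖φ (lower ((ϖ : F) ^ k))‖ ≤
      (resCard F : ℝ) ^ k * ‖(μ₂ ϖ : ℂ)‖ ^ k)
    {α : ℝ} (hα₁ : ‖(μ₁ ϖ : ℂ)‖ ≤ (resCard F : ℝ) ^ α) (hα₂ : ‖(μ₂ ϖ : ℂ)‖ ≤ (resCard F : ℝ) ^ α)
    {n : ℤ} (hn : -k ≤ n) (hna : n ≤ ord (a : F) - k) :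
    ‖∫ m in fracIdeal F n \ fracIdeal F (n + 1), orbitValue φ a z m * (ψ (-m) : ℂ) ∂dm‖ ≤
      (resCard F : ℝ) ^ k * (resCard F : ℝ) ^ ((α - 1 / 2) * (ord (a : F) : ℝ)) := by
  have hp := resCard_pos F
  set q : ℝ := (resCard F : ℝ) with hq
  set x := ‖(μ₁ ϖ : ℂ)‖ with hx
  set y := ‖(μ₂ ϖ : ℂ)‖ with hy
  set f := ‖φ (lower ((ϖ : F) ^ k))‖ with hf
  have hx0 : 0 < x := norm_pos_iff.2 (Units.ne_zero _)
  have hy0 : 0 < y := norm_pos_iff.2 (Units.ne_zero _)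
  set va := ord (a : F) with hva
  set C := x ^ (va - n) * y ^ n * (q ^ (-(va : ℝ) / 2) * q ^ n) * f with hC
  have hsub : fracIdeal F n \ fracIdeal F (n + 1) ⊆ fracIdeal F n := Set.sdiff_subset
  have hvol : dm.real (fracIdeal F n \ fracIdeal F (n + 1)) ≤ q ^ (-n) := by
    rw [hq, ← measureReal_fracIdeal hϖ hdm n]
    exact measureReal_mono hsub (measure_fracIdeal_lt_top dm n).ne
  have h1 : ‖∫ m in fracIdeal F n \ fracIdeal F (n + 1), orbitValue φ a z m * (ψ (-m) : ℂ) ∂dm‖ ≤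
      C * dm.real (fracIdeal F n \ fracIdeal F (n + 1)) := by
    refine norm_setIntegral_le_of_norm_le_const
      ((measure_mono hsub).trans_lt (measure_fracIdeal_lt_top dm n)) fun m hm => ?_
    have hm0 : m ≠ 0 := by
      rintro rfl
      exact hm.2 (zero_mem_fracIdeal _)
    have hmn : ord m = n := by
      have h2 := hm.1
      have h3 := hm.2
      rw [mem_fracIdeal_iff_of_ne hm0] at h2 h3
      omega
    lift m to Fˣ using IsUnit.mk0 m hm0
    rw [norm_mul, Circle.norm_coe, mul_one]
    have := hφ.norm_orbitValue_le hk h₁ h₂ hϖ a m z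
    rwa [hmn] at this
  have hC0 : 0 ≤ C := by positivity
  refine h1.trans ((mul_le_mul_of_nonneg_left hvol hC0).trans ?_)
  obtain ⟨i, hi⟩ := Int.eq_ofNat_of_zero_le (show 0 ≤ va - n - k by omega)
  obtain ⟨j, hj⟩ := Int.eq_ofNat_of_zero_le (show 0 ≤ n + k by omega)
  have e1 : x ^ (va - n) = x ^ i * x ^ k := by
    rw [← zpow_natCast, ← zpow_natCast, ← zpow_add₀ hx0.ne']
    congr 1
    omega
  have e2 : y ^ j = y ^ n * y ^ k := by
    rw [← zpow_natCast, ← zpow_natCast, ← zpow_add₀ hy0.ne']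
    congr 1
    omega
  have e3 : (q ^ α) ^ i * (q ^ α) ^ j = q ^ (α * va) := by
    rw [← pow_add, ← Real.rpow_natCast, ← Real.rpow_mul hp.le]
    congr 2
    have : (va : ℝ) = ((i + j : ℤ) : ℝ) := by
      congr 1
      omega
    rw [this]
    push_cast
    ring
  calc C * q ^ (-n) = x ^ i * (y ^ n * q ^ (-(va : ℝ) / 2)) * (x ^ k * f) * (q ^ n * q ^ (-n)) := by
        rw [hC, e1]
        ring
    _ = x ^ i * (y ^ n * q ^ (-(va : ℝ) / 2)) * (x ^ k * f) := by
        rw [← zpow_add₀ hp.ne', add_neg_cancel, zpow_zero, mul_one]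
    _ ≤ x ^ i * (y ^ n * q ^ (-(va : ℝ) / 2)) * (q ^ k * y ^ k) := by gcongr
    _ = q ^ k * (x ^ i * y ^ j * q ^ (-(va : ℝ) / 2)) := by
        rw [e2]
        ring
    _ ≤ q ^ k * ((q ^ α) ^ i * (q ^ α) ^ j * q ^ (-(va : ℝ) / 2)) := by gcongr
    _ = _ := by
        rw [e3, ← Real.rpow_add hp]
        congr 2
        ring

/-- Bound for the truncated Whittaker integral at `diag(a, 1) * lower (ϖ ^ k)`. -/
theorem norm_setIntegral_fracIdeal_le (hφ : IsFixedVector μ₁ μ₂ (2 * k) φ)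
    (hk : 1 ≤ k) (h₁ : HasLevel μ₁ k) (h₂ : HasLevel μ₂ k) {ϖ : Fˣ} (hϖ : ord (ϖ : F) = 1)
    {ψ : AddChar F Circle} (hψ : IsUnramified ψ) (a : Fˣ) {B : ℝ} (hB : 0 ≤ B)
    (hshell : ∀ n : ℤ, -k ≤ n → n ≤ ord (a : F) - k →
      ‖∫ m in fracIdeal F n \ fracIdeal F (n + 1),
        orbitValue φ a ((ϖ : F) ^ k) m * (ψ (-m) : ℂ) ∂dm‖ ≤ B) (n : ℤ) :
    ‖∫ m in fracIdeal F n, orbitValue φ a ((ϖ : F) ^ k) m * (ψ (-m) : ℂ) ∂dm‖ ≤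
      max 0 ((ord (a : F) : ℝ) + 1) * B := by
  set I : F → ℂ := fun m => orbitValue φ a ((ϖ : F) ^ k) m * (ψ (-m) : ℂ) with hI
  have hzord : ord ((ϖ : F) ^ k) = k := by rw [ord_pow ϖ.ne_zero, hϖ, mul_one]
  have hz : (ϖ : F) ^ k ∈ fracIdeal F k := by
    rw [mem_fracIdeal_iff, hzord]
    exact Or.inr le_rfl
  have hstep : ∀ n : ℤ, ∫ m in fracIdeal F n, I m ∂dm = ∫ m in fracIdeal F (n + 1), I m ∂dm +
      ∫ m in fracIdeal F n \ fracIdeal F (n + 1), I m ∂dm := by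
    intro n
    rw [setIntegral_sdiff (measurableSet_fracIdeal _)
      ((hφ.continuous_integrand a hz hψ).continuousOn.integrableOn_compact' (isCompact_fracIdeal n)
        (measurableSet_fracIdeal n)) (fracIdeal_anti (show n ≤ n + 1 by omega)), add_sub_cancel]
  have hlarge : ∀ n : ℤ, ord (a : F) - k < n → ∫ m in fracIdeal F n, I m ∂dm = 0 := by
    intro n hn
    refine setIntegral_eq_zero_of_forall_eq_zero fun m hm => ?_
    suffices h : orbitValue φ a ((ϖ : F) ^ k) m = 0 by rw [hI]; simp [h]
    by_cases hm0 : m = 0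
    · rw [hm0]
      exact hφ.orbitValue_zero hk h₁ h₂ hϖ a hz
    rw [mem_fracIdeal_iff_of_ne hm0] at hm
    lift m to Fˣ using IsUnit.mk0 m hm0
    by_contra h
    have h2 := (hφ.ord_of_orbitValue_ne_zero hk h₁ h₂ h).2
    have h4 : ord ((a : F) * ((m⁻¹ : Fˣ) : F)) = ord (a : F) - ord (m : F) := by
      rw [ord_mul a.ne_zero (Units.ne_zero _), Units.val_inv_eq_inv_val, ord_inv]
      ring
    have h3 := ord_add_of_mem (mul_ne_zero a.ne_zero (Units.ne_zero m⁻¹))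
      (fracIdeal_anti (by omega) hz)
    rw [add_comm] at h3
    omega
  -- Only shells with `-k ≤ n ≤ v a - k` contribute, so descending induction on `n` gives `B` times
  -- the number of those shells of index at least `n`.
  have hmain : ∀ j : ℕ, ‖∫ m in fracIdeal F (ord (a : F) - k + 1 - j), I m ∂dm‖ ≤
      max 0 (min (j : ℝ) ((ord (a : F) : ℝ) + 1)) * B := by
    intro j
    induction j with
    | zero =>
      rw [hlarge _ (by push_cast; omega), norm_zero]
      positivity
    | succ j ih =>
      rw [hstep]
      have e : ord (a : F) - k + 1 - ((j + 1 : ℕ) : ℤ) + 1 = ord (a : F) - k + 1 - j := by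
        push_cast
        ring
      rw [e]
      by_cases hj : ord (a : F) - k + 1 - ((j + 1 : ℕ) : ℤ) < -k
      · have h0 := setIntegral_shell_eq_zero (dm := dm) hφ hk h₁ h₂ hψ a hz hj
        rw [e] at h0
        rw [h0, add_zero]
        refine ih.trans ?_
        gcongr
        omega
      · have hb := hshell (ord (a : F) - k + 1 - ((j + 1 : ℕ) : ℤ)) (by omega)
          (by push_cast; omega)
        rw [e] at hb
        have hja : (j : ℝ) + 1 ≤ (ord (a : F) : ℝ) + 1 := by
          have : (j : ℤ) ≤ ord (a : F) := by push_cast at hj; omega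
          have : (j : ℝ) ≤ (ord (a : F) : ℝ) := by exact_mod_cast this
          linarith
        rw [min_eq_left (by linarith), max_eq_right (by positivity)] at ih
        rw [Nat.cast_succ (R := ℝ), min_eq_left hja, max_eq_right (by positivity), add_mul, one_mul]
        exact (norm_add_le _ _).trans (add_le_add ih hb)
  rcases lt_or_ge (ord (a : F) - k) n with hn | hn
  · rw [hlarge n hn, norm_zero]
    positivity
  · obtain ⟨j, hj⟩ := Int.eq_ofNat_of_zero_le (show 0 ≤ ord (a : F) - k + 1 - n by omega)
    have h := hmain j
    rw [← hj, sub_sub_cancel] at h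
    refine h.trans ?_
    gcongr
    exact min_le_right _ _

end Newform

end GL2Whittaker

theorem lemma2p13 (k p : ℕ) (hk : 1 ≤ k) :
    ∃ C : ℝ, 0 < C ∧
      ∀ (F : Type*) [Field F] [ValuativeRel F] [TopologicalSpace F]
        [IsNonarchimedeanLocalField F] [MeasurableSpace F] [BorelSpace F],
        resCard F = p →
      ∀ (dm : MeasureTheory.Measure F) [dm.IsAddHaarMeasure], dm (fracIdeal F 0) = 1 →
      ∀ ψ : AddChar F Circle, IsUnramified ψ →
      ∀ ϖ : Fˣ, ord (ϖ : F) = 1 →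
      ∀ μ₁ μ₂ : Fˣ →* ℂˣ, HasLevel μ₁ k → HasLevel μ₂ k →
      ∀ α : ℝ, IsRamanujanBound α ϖ μ₁ → IsRamanujanBound α ϖ μ₂ →
      ∀ W : GL (Fin 2) F → ℂ, IsWhittakerNewform dm ψ μ₁ μ₂ k W →
      ∀ a : Fˣ,
        ‖whittakerCoset W ϖ k a‖ ≤
          C * (p : ℝ) ^ ((α - 1 / 2) * (ord (a : F) : ℝ)) * max 1 |(ord (a : F) : ℝ)| := by
  -- The summand `1` only serves to make the constant positive when `p = 0`.
  refine ⟨2 * (p : ℝ) ^ k + 1, by positivity, ?_⟩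
  intro F _ _ _ _ _ _ hp dm _ hdm ψ hψ ϖ hϖ μ₁ μ₂ h₁ h₂ α hα₁ hα₂ W hW a
  obtain ⟨⟨φ, hφ, hWφ⟩, hW1⟩ := hW
  subst hp
  have hnorm := norm_apply_lower_le_of_normalized hφ hk h₁ h₂ hϖ hdm hψ hWφ hW1
  set q : ℝ := (resCard F : ℝ)
  set E : ℝ := q ^ ((α - 1 / 2) * (ord (a : F) : ℝ))
  have hE : 0 ≤ E := by positivity
  have hbound := fun n => norm_setIntegral_fracIdeal_le (dm := dm) hφ hk h₁ h₂ hϖ hψ a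
    (B := q ^ k * E) (by positivity)
    (fun n hn hna => norm_setIntegral_shell_le hφ hk h₁ h₂ hϖ hdm ψ a ((ϖ : F) ^ k) hnorm
      hα₁.2 hα₂.2 hn hna) n
  refine (le_of_tendsto (hWφ (upper a 0 1 * lower ((ϖ : F) ^ k))).norm
    (Eventually.of_forall fun N => hbound (-N))).trans ?_
  have hmax : max 0 ((ord (a : F) : ℝ) + 1) ≤ 2 * max 1 |(ord (a : F) : ℝ)| := by
    have h3 := le_max_left 1 |(ord (a : F) : ℝ)|
    have h4 := (le_abs_self (ord (a : F) : ℝ)).trans (le_max_right 1 _)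
    exact max_le (by linarith) (by linarith)
  calc max 0 ((ord (a : F) : ℝ) + 1) * (q ^ k * E)
      ≤ 2 * max 1 |(ord (a : F) : ℝ)| * (q ^ k * E) := by gcongr
    _ = 2 * q ^ k * E * max 1 |(ord (a : F) : ℝ)| := by ring
    _ ≤ (2 * q ^ k + 1) * E * max 1 |(ord (a : F) : ℝ)| := by gcongr; linarith
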